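/- Work over $\mathbb{C}$. Identify a point $[a_0:\dots:a_n]\in\mathbb{P}^n$ with the class of the linear form $a_0x_0+\dots+a_nx_n$, and let $v_d:\mathbb{P}^n\to\mathbb{P}(S^d\mathbb{C}^{n+1})$, $[L]\mapsto[L^d]$, be the Veronese map. For a finite set $A\subset\mathbb{P}^n$ write $\ell(A)$ for its cardinality, $I_A\subset R=\mathbb{C}[x_0,\dots,x_n]$ for its homogeneous ideal, $(I_A)_j$ for the degree $j$ piece of $I_A$, and $h_A(j)$ for the Hilbert function of $A$, i.e. the rank of the evaluation map $R_j\to\mathbb{C}^{\ell(A)}$ at homogeneous coordinates of the points of $A$. The $d$-th Kruskal rank $k_d(A)$ is the largest $k\le\ell(A)$ such that $v_d$ maps every subset of at most $k$ points of $A$ to linearly independent points. A finite set $A$ is a decomposition of a form $T$ of degree $d$ if $T$ lies in the linear span of $v_d(A)$; it is non-redundant for $T$ if moreover no proper subset of $A$ is a decomposition of $T$. Let $T\in S^4\mathbb{C}^5$ be a quartic form in five variables and let $A\subset\mathbb{P}^4$ be a set of $13$ points such that (i) $A$ is a non-redundant decomposition of $T$; (ii) $k_1(A)=5$; (iii) $k_2(A)=13$;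 (iv') for every subset $A'\subset A$ with $\ell(A')\le 11$, the base locus of the linear system of quadric hypersurfaces containing $A'$ is finite. Let $B\subset\mathbb{P}^4$ be a finite set which is a decomposition of $T$, with $\ell(B)\le 13$ and $A\cap B=\emptyset$, and put $Z=A\cup B$. Then $\ell(B)=13$, $(I_Z)_j=(I_A)_j$ for all $j\le 2$, and $h_Z(3)\le 21$. -/

import Mathlib

open MvPolynomial

open scoped LinearAlgebra.Projectivization

namespace Waring

noncomputable section

/-- The complex projective space `ℙⁿ`. A point `[a₀ : … : aₙ]` also stands for the class of the
linear form `a₀ x₀ + … + aₙ xₙ`. -/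
abbrev PSpace (n : ℕ) : Type := ℙ ℂ (Fin (n + 1) → ℂ)

/-- The space `S^d ℂ^{n+1}` of forms of degree `d` in `x₀, …, xₙ` over `ℂ` (the zero form is
included). -/
abbrev Form (n d : ℕ) : Type := homogeneousSubmodule (Fin (n + 1)) ℂ d

/-- The linear form `a₀ x₀ + … + aₙ xₙ`. -/
def linForm {n : ℕ} (a : Fin (n + 1) → ℂ) : MvPolynomial (Fin (n + 1)) ℂ :=
  ∑ i, C (a i) * X i

theorem linForm_isHomogeneous {n : ℕ} (a : Fin (n + 1) → ℂ) : (linForm a).IsHomogeneous 1 :=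
  IsHomogeneous.sum _ _ _ fun i _ => by
    simpa using (isHomogeneous_C (Fin (n + 1)) (a i)).mul (isHomogeneous_X ℂ i)

theorem linForm_smul {n : ℕ} (c : ℂ) (a : Fin (n + 1) → ℂ) :
    linForm (c • a) = C c * linForm a := by
  simp [linForm, Finset.mul_sum, mul_assoc]

theorem linForm_ne_zero {n : ℕ} {a : Fin (n + 1) → ℂ} (ha : a ≠ 0) : linForm a ≠ 0 := by
  classical
  intro h
  apply ha
  funext i
  have h1 := congrArg (eval (Pi.single i (1 : ℂ))) h
  simpa [linForm, Pi.single_apply] using h1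

/-- The `d`-th power of the linear form `a₀ x₀ + … + aₙ xₙ`, as a form of degree `d`. -/
def linPow {n : ℕ} (d : ℕ) (a : Fin (n + 1) → ℂ) : Form n d :=
  ⟨linForm a ^ d, by simpa using (linForm_isHomogeneous a).pow d⟩

theorem linPow_ne_zero {n : ℕ} (d : ℕ) {a : Fin (n + 1) → ℂ} (ha : a ≠ 0) : linPow d a ≠ 0 :=
  fun h => pow_ne_zero d (linForm_ne_zero ha) (congrArg Subtype.val h)

theorem linPow_smul {n : ℕ} (d : ℕ) (c : ℂ) (a : Fin (n + 1) → ℂ) :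
    linPow d (c • a) = c ^ d • linPow d a := by
  apply Subtype.ext
  change linForm (c • a) ^ d = c ^ d • linForm a ^ d
  rw [linForm_smul, mul_pow, ← C_pow, smul_eq_C_mul]

/-- The Veronese map `v_d : ℙⁿ → ℙ(S^d ℂ^{n+1})`, `[L] ↦ [L ^ d]`. By `veronese_mk` it does not
depend on the representatives. -/
def veronese {n : ℕ} (d : ℕ) (P : PSpace n) : ℙ ℂ (Form n d) :=
  Projectivization.mk ℂ (linPow d P.rep) (linPow_ne_zero d P.rep_nonzero)

theorem veronese_mk {n : ℕ} (d : ℕ) (a : Fin (n + 1) → ℂ) (ha : a ≠ 0) :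
    veronese d (Projectivization.mk ℂ a ha) =
      Projectivization.mk ℂ (linPow d a) (linPow_ne_zero d ha) := by
  obtain ⟨c, hc⟩ := Projectivization.exists_smul_eq_mk_rep ℂ a ha
  rw [veronese, Projectivization.mk_eq_mk_iff']
  exact ⟨(c : ℂ) ^ d, by rw [← linPow_smul, ← hc]; rfl⟩

/-- The linear span `⟨v_d(A)⟩`, as the linear subspace of forms lying over it. -/
def veroneseSpan {n : ℕ} (d : ℕ) (A : Finset (PSpace n)) : Submodule ℂ (Form n d) :=
  ⨆ P ∈ A, (veronese d P).submodule

/-- `A` computes `T`, i.e. `A` is a decomposition of `T`: `T ∈ ⟨v_d(A)⟩`. -/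
def Computes {n d : ℕ} (A : Finset (PSpace n)) (T : Form n d) : Prop :=
  T ∈ veroneseSpan d A

/-- `A` is a non-redundant decomposition of `T`: it computes `T` and no proper subset does. -/
def IsNonRedundant {n d : ℕ} (A : Finset (PSpace n)) (T : Form n d) : Prop :=
  Computes A T ∧ ∀ A' : Finset (PSpace n), A' ⊂ A → ¬ Computes A' T

/-- The `d`-th Kruskal rank `k_d(A)`: the largest `k ≤ ℓ(A)` such that `v_d` maps every subset of
`A` with at most `k` elements to linearly independent points. -/
def kruskalRank {n : ℕ} (d : ℕ) (A : Finset (PSpace n)) : ℕ :=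
  sSup {k : ℕ | k ≤ A.card ∧ ∀ A' : Finset (PSpace n), A' ⊆ A → A'.card ≤ k →
    Projectivization.Independent fun P : A' => veronese d (P : PSpace n)}

/-- The homogeneous ideal `I_A` of a finite set `A ⊆ ℙⁿ`: the polynomials that vanish at all
homogeneous coordinates of all points of `A`. -/
def idealOf {n : ℕ} (A : Finset (PSpace n)) : Ideal (MvPolynomial (Fin (n + 1)) ℂ) where
  carrier := {F | ∀ (v : Fin (n + 1) → ℂ) (hv : v ≠ 0),
    Projectivization.mk ℂ v hv ∈ A → eval v F = 0}
  add_mem' := fun {F G} hF hG v hv hP => by rw [map_add, hF v hv hP, hG v hv hP, add_zero]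
  zero_mem' := fun v _ _ => map_zero (eval v)
  smul_mem' := fun G F hF v hv hP => by rw [smul_eq_mul, map_mul, hF v hv hP, mul_zero]

/-- The homogeneous piece `(I_A)_j` of degree `j`. -/
def idealPiece {n : ℕ} (A : Finset (PSpace n)) (j : ℕ) :
    Submodule ℂ (MvPolynomial (Fin (n + 1)) ℂ) :=
  (idealOf A).restrictScalars ℂ ⊓ homogeneousSubmodule (Fin (n + 1)) ℂ j

/-- The base locus of the linear system of quadric hypersurfaces passing through `A`. -/
def quadricBaseLocus {n : ℕ} (A : Finset (PSpace n)) : Set (PSpace n) :=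
  {P | ∀ F ∈ idealPiece A 2, eval P.rep F = 0}

/-- The evaluation map of degree `j` on a set of homogeneous coordinates of `Z`. -/
def evMap {n : ℕ} (Z : Finset (PSpace n)) (j : ℕ) : Form n j →ₗ[ℂ] (Z → ℂ) :=
  LinearMap.pi fun P =>
    (aeval (R := ℂ) (P : PSpace n).rep).toLinearMap ∘ₗ
      (homogeneousSubmodule (Fin (n + 1)) ℂ j).subtype

/-- The Hilbert function `h_Z(j)`, the rank of the evaluation map of degree `j ≥ 0`. -/
def hilbertFunction {n : ℕ} (Z : Finset (PSpace n)) (j : ℕ) : ℕ :=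
  Module.finrank ℂ (LinearMap.range (evMap Z j))

end

end Waring

namespace Waring

/-! Replace `B` by a non-redundant `B' ⊆ B` and put `Z = A ∪ B'`. Subtracting the two expressions of
`T` and applying apolarity gives a relation `∑ w P * F(P) = 0` over `Z`, valid for all quartics `F`,
with every `w P ≠ 0`. For `i + j = 4` the evaluation images in degrees `i` and `j` are then
orthogonal for a nondegenerate form on `ℂ^Z`, so `h_Z(i) + h_Z(j) ≤ ℓ(Z)`. The Kruskal ranks give
`h_Z(2) ≥ h_A(2) ≥ 13` and `h_Z(1) ≥ 5`. Since `ℓ(Z) ≤ 26`, the case `(2,2)` forces `ℓ(B') = 13` and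
`h_Z(2) = h_A(2)`, and the case `(1,3)` gives `h_Z(3) ≤ 21`. -/

/-- Apolarity: evaluation of forms of degree `d` at a point is a functional of `d`-th powers. -/
theorem exists_dual_linPow {n d : ℕ} (F : Form n d) :
    ∃ φ : Form n d →ₗ[ℂ] ℂ, ∀ a : Fin (n + 1) → ℂ, φ (linPow d a) = eval a F.1 := by
  -- The coefficient of `x^m` in `L^d` is the multinomial of `m` times `a^m`; dividing by it leaves
  -- the monomial `a^m`.
  refine ⟨(∑ m ∈ F.1.support, (coeff m F.1 / m.multinomial) • lcoeff ℂ m) ∘ₗ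
    (homogeneousSubmodule (Fin (n + 1)) ℂ d).subtype, fun a => ?_⟩
  rw [eval_eq]
  simp only [LinearMap.comp_apply, LinearMap.sum_apply, LinearMap.smul_apply, smul_eq_mul,
    Submodule.subtype_apply, lcoeff_apply]
  refine Finset.sum_congr rfl fun m hm => ?_
  have hdeg : m.sum (fun _ k => k) = d := by
    have h := (mem_homogeneousSubmodule d F.1).1 F.2 (mem_support_iff.1 hm)
    rw [← h, Finsupp.weight_apply]
    simp
  have hL : (linPow d a).1 = (∑ i, a i • X i) ^ d := by
    simp [linPow, linForm, smul_eq_C_mul]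
  have hpos : (m.multinomial : ℂ) ≠ 0 := by
    exact_mod_cast (Nat.multinomial_pos m.support m).ne'
  rw [hL, coeff_linearCombination_X_pow_of_fintype, if_pos hdeg, Finsupp.prod]
  field_simp

theorem mem_veroneseSpan_iff {n d : ℕ} {A : Finset (PSpace n)} {T : Form n d} :
    T ∈ veroneseSpan d A ↔ ∃ a : PSpace n → ℂ, ∑ P ∈ A, a P • linPow d P.rep = T := by
  simp only [veroneseSpan, veronese, Projectivization.submodule_mk,
    Submodule.mem_iSup_finset_iff_exists_sum]
  constructor
  · rintro ⟨μ, hμ⟩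
    choose a ha using fun P => Submodule.mem_span_singleton.1 (μ P).2
    exact ⟨a, by simpa only [ha] using hμ⟩
  · rintro ⟨a, ha⟩
    exact ⟨fun P => ⟨a P • linPow d P.rep, Submodule.smul_mem _ _
      (Submodule.mem_span_singleton_self _)⟩, ha⟩

theorem IsNonRedundant.exists_coeff {n d : ℕ} {A : Finset (PSpace n)} {T : Form n d}
    (h : IsNonRedundant A T) :
    ∃ a : PSpace n → ℂ, (∀ P ∈ A, a P ≠ 0) ∧ ∑ P ∈ A, a P • linPow d P.rep = T := by
  classical
  obtain ⟨a, ha⟩ := mem_veroneseSpan_iff.1 h.1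
  refine ⟨a, fun P hP h0 => h.2 _ (Finset.erase_ssubset hP) (mem_veroneseSpan_iff.2 ⟨a, ?_⟩), ha⟩
  rw [← ha, ← Finset.add_sum_erase A _ hP, h0, zero_smul, zero_add]

theorem Computes.exists_isNonRedundant {n d : ℕ} {B : Finset (PSpace n)} {T : Form n d}
    (h : Computes B T) : ∃ B' ⊆ B, IsNonRedundant B' T := by
  induction B using Finset.strongInduction with
  | H B ih =>
    by_cases hB : ∃ B' ⊂ B, Computes B' T
    · obtain ⟨B', hB', hT⟩ := hB
      obtain ⟨B'', hsub, hred⟩ := ih B' hB' hT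
      exact ⟨B'', hsub.trans hB'.subset, hred⟩
    · exact ⟨B, subset_rfl, h, fun B' hB' hT => hB ⟨B', hB', hT⟩⟩

/-- Disjoint non-redundant decompositions of the same form yield a relation, with all
coefficients nonzero, between the evaluations at the points of their union. -/
theorem exists_relation {n d : ℕ} [DecidableEq (PSpace n)] {A B : Finset (PSpace n)}
    {T : Form n d} (hA : IsNonRedundant A T) (hB : IsNonRedundant B T) (hAB : Disjoint A B) :
    ∃ w : PSpace n → ℂ, (∀ P ∈ A ∪ B, w P ≠ 0) ∧
      ∀ F : Form n d, ∑ P ∈ A ∪ B, w P * eval P.rep F.1 = 0 := by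
  obtain ⟨a, ha, haT⟩ := hA.exists_coeff
  obtain ⟨b, hb, hbT⟩ := hB.exists_coeff
  have hBA : ∀ P ∈ B, P ∉ A := fun P hP hPA => Finset.disjoint_left.1 hAB hPA hP
  refine ⟨fun P => if P ∈ A then a P else -b P, fun P hP => ?_, fun F => ?_⟩
  · by_cases h : P ∈ A
    · simpa [h] using ha P h
    · simpa [h] using hb P ((Finset.mem_union.1 hP).resolve_left h)
  · obtain ⟨φ, hφ⟩ := exists_dual_linPow F
    have h1 : φ T = ∑ P ∈ A, a P * eval P.rep F.1 := by simp [← haT, hφ]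
    have h2 : φ T = ∑ P ∈ B, b P * eval P.rep F.1 := by simp [← hbT, hφ]
    rw [Finset.sum_union hAB,
      Finset.sum_congr rfl (g := fun P => a P * eval P.rep F.1) fun P hP => by simp [hP],
      Finset.sum_congr (s₁ := B) rfl (g := fun P => -(b P * eval P.rep F.1))
        fun P hP => by simp [hBA P hP],
      Finset.sum_neg_distrib, ← h1, ← h2, add_neg_cancel]

/-- `V` and `W` are orthogonal for the diagonal form with entries `w`, nondegenerate because no
entry vanishes. -/
theorem finrank_add_finrank_le_card {ι : Type*} [Fintype ι] (w : ι → ℂ) (hw : ∀ i, w i ≠ 0)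
    (V W : Submodule ℂ (ι → ℂ)) (h : ∀ f ∈ V, ∀ g ∈ W, ∑ i, w i * (f i * g i) = 0) :
    Module.finrank ℂ V + Module.finrank ℂ W ≤ Fintype.card ι := by
  classical
  set β : LinearMap.BilinForm ℂ (ι → ℂ) := Matrix.toBilin' (Matrix.diagonal w)
  have hβ : β.Nondegenerate := by
    rw [LinearMap.BilinForm.nondegenerate_toBilin'_iff_det_ne_zero, Matrix.det_diagonal]
    exact Finset.prod_ne_zero_iff.2 fun i _ => hw i
  have hle : W ≤ β.orthogonal V := fun g hg f hf => by
    rw [← h f hf g hg]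
    simp only [β, Matrix.toBilin'_apply', Matrix.mulVec_diagonal, dotProduct]
    exact Finset.sum_congr rfl fun i _ => by ring
  have h1 := Submodule.finrank_mono hle
  rw [LinearMap.BilinForm.finrank_orthogonal hβ] at h1
  have h2 := Submodule.finrank_le V
  rw [Module.finrank_fintype_fun_eq_card] at h1 h2
  omega

theorem evMap_apply {n j : ℕ} (Z : Finset (PSpace n)) (F : Form n j) (P : Z) :
    evMap Z j F P = eval P.1.rep F.1 := by
  simp [evMap, aeval_eq_eval]

/-- A product of forms of degrees `i` and `j` has degree `i + j`, so the relation among evaluations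
pairs the two images to zero. -/
theorem hilbertFunction_add_le {n i j : ℕ} [DecidableEq (PSpace n)] {A B : Finset (PSpace n)}
    {T : Form n (i + j)} (hA : IsNonRedundant A T) (hB : IsNonRedundant B T)
    (hAB : Disjoint A B) :
    hilbertFunction (A ∪ B) i + hilbertFunction (A ∪ B) j ≤ (A ∪ B).card := by
  obtain ⟨w, hw, hsum⟩ := exists_relation hA hB hAB
  rw [← Fintype.card_coe]
  refine finrank_add_finrank_le_card (fun P => w P.1) (fun P => hw P.1 P.2) _ _ ?_
  rintro _ ⟨F, rfl⟩ _ ⟨G, rfl⟩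
  have h := hsum ⟨F.1 * G.1, IsHomogeneous.mul F.2 G.2⟩
  rw [← Finset.sum_coe_sort] at h
  simpa only [evMap_apply, map_mul] using h

theorem range_evMap_of_subset {n j : ℕ} {A Z : Finset (PSpace n)} (h : A ⊆ Z) :
    LinearMap.range (evMap A j) = (LinearMap.range (evMap Z j)).map
      (LinearMap.funLeft ℂ ℂ fun P : A => (⟨P.1, h P.2⟩ : Z)) := by
  rw [← LinearMap.range_comp]
  rfl

theorem hilbertFunction_mono {n j : ℕ} {A Z : Finset (PSpace n)} (h : A ⊆ Z) :
    hilbertFunction A j ≤ hilbertFunction Z j := by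
  rw [hilbertFunction, range_evMap_of_subset h]
  exact Submodule.finrank_map_le _ _

/-- A functional killing all evaluation vectors would be a linear relation among the powers `L_P^d`,
by the symmetry `L_P(y) = L_y(P)`. -/
theorem hilbertFunction_eq_card {n d : ℕ} {A : Finset (PSpace n)}
    (h : Projectivization.Independent fun P : A => veronese d (P : PSpace n)) :
    hilbertFunction A d = A.card := by
  have hlin : LinearIndependent ℂ fun P : A => linPow d P.1.rep := by
    rw [Projectivization.independent_iff_iSupIndep] at h
    simp only [veronese, Projectivization.submodule_mk] at h
    exact (iSupIndep_iff_linearIndependent_of_ne_zero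
      fun P : A => linPow_ne_zero d P.1.rep_nonzero).1 h
  suffices htop : LinearMap.range (evMap A d) = ⊤ by
    rw [hilbertFunction, htop, finrank_top, Module.finrank_fintype_fun_eq_card, Fintype.card_coe]
  by_contra hne
  classical
  obtain ⟨φ, hφ, hker⟩ := Submodule.exists_le_ker_of_lt_top _ (lt_top_iff_ne_top.2 hne)
  have hφ' : ∀ f, φ f = ∑ P, f P * φ (Pi.single P 1) := fun f => by
    conv_lhs => rw [pi_eq_sum_univ' f]
    simp
  have hrel : ∑ P : A, φ (Pi.single P 1) • linPow d P.1.rep = 0 := by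
    apply Subtype.ext
    refine MvPolynomial.funext fun y => ?_
    have h0 : φ (evMap A d (linPow d y)) = 0 := hker ⟨_, rfl⟩
    rw [hφ'] at h0
    simp only [evMap_apply] at h0
    simp only [Submodule.coe_sum, Submodule.coe_smul, map_sum, smul_eval, ZeroMemClass.coe_zero,
      map_zero]
    rw [← h0]
    refine Finset.sum_congr rfl fun P _ => ?_
    rw [mul_comm]
    congr 1
    simp [linPow, linForm, mul_comm]
  have hc := Fintype.linearIndependent_iff.1 hlin _ hrel
  exact hφ (LinearMap.ext fun f => by simp [hφ' f, hc])

theorem kruskalRank_le_hilbertFunction {n : ℕ} (d : ℕ) (A : Finset (PSpace n)) :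
    kruskalRank d A ≤ hilbertFunction A d := by
  have hmem : kruskalRank d A ∈ {k : ℕ | k ≤ A.card ∧ ∀ A' : Finset (PSpace n), A' ⊆ A →
      A'.card ≤ k → Projectivization.Independent fun P : A' => veronese d (P : PSpace n)} := by
    -- The supremum is attained: `0` belongs to the set, and `A.card` bounds it.
    refine Nat.sSup_mem ⟨0, Nat.zero_le _, fun A' _ h => ?_⟩ ⟨A.card, fun k hk => hk.1⟩
    have : IsEmpty A' := by
      rw [Finset.card_eq_zero.1 (Nat.le_zero.1 h)]
      infer_instance
    rw [Projectivization.independent_iff]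
    exact linearIndependent_empty_type
  obtain ⟨A', hA', hcard⟩ := Finset.exists_subset_card_eq hmem.1
  rw [← hcard, ← hilbertFunction_eq_card (hmem.2 A' hA' hcard.le)]
  exact hilbertFunction_mono hA'

theorem eval_rep_eq_zero_of_mem_idealPiece {n j : ℕ} {A : Finset (PSpace n)}
    {F : MvPolynomial (Fin (n + 1)) ℂ} (hF : F ∈ idealPiece A j) {P : PSpace n} (hP : P ∈ A) :
    eval P.rep F = 0 :=
  hF.1 P.rep P.rep_nonzero (by rwa [Projectivization.mk_rep])

theorem eval_smul_of_isHomogeneous {σ : Type*} [Fintype σ] {F : MvPolynomial σ ℂ} {j : ℕ}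
    (hF : F.IsHomogeneous j) (c : ℂ) (v : σ → ℂ) : eval (c • v) F = c ^ j * eval v F := by
  rw [eval_eq', eval_eq', Finset.mul_sum]
  refine Finset.sum_congr rfl fun m hm => ?_
  have hdeg : ∑ i, m i = j := by
    rw [← Finsupp.degree_eq_sum, Finsupp.degree_eq_weight_one]
    exact hF (mem_support_iff.1 hm)
  simp only [Pi.smul_apply, smul_eq_mul, mul_pow, Finset.prod_mul_distrib,
    Finset.prod_pow_eq_pow_sum, hdeg]
  ring

theorem mem_idealPiece_of_eval_rep {n j : ℕ} {A : Finset (PSpace n)}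
    {F : MvPolynomial (Fin (n + 1)) ℂ} (hF : F.IsHomogeneous j)
    (h : ∀ P ∈ A, eval P.rep F = 0) : F ∈ idealPiece A j := by
  refine ⟨fun v hv hP => ?_, hF⟩
  obtain ⟨c, hc⟩ := Projectivization.exists_smul_eq_mk_rep ℂ v hv
  have h0 := h _ hP
  rw [← hc, Units.smul_def] at h0
  have h1 : eval ((c : ℂ) • v) F = (c : ℂ) ^ j * eval v F := eval_smul_of_isHomogeneous hF _ _
  rw [h1] at h0
  exact (mul_eq_zero.1 h0).resolve_left (pow_ne_zero _ c.ne_zero)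

theorem idealPiece_anti {n j : ℕ} {A Z : Finset (PSpace n)} (h : A ⊆ Z) :
    idealPiece Z j ≤ idealPiece A j :=
  fun _ hF => ⟨fun v hv hP => hF.1 v hv (h hP), hF.2⟩

/-- Restriction from `Z` to `A` maps the evaluation image on `Z` onto that on `A`. Under the rank
bound it is injective, so a form vanishing on `A` vanishes on `Z`. -/
theorem idealPiece_eq_of_hilbertFunction_le {n j : ℕ} {A Z : Finset (PSpace n)} (hAZ : A ⊆ Z)
    (h : hilbertFunction Z j ≤ hilbertFunction A j) : idealPiece Z j = idealPiece A j := by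
  refine le_antisymm (idealPiece_anti hAZ) fun F hF => mem_idealPiece_of_eval_rep hF.2 ?_
  set r := LinearMap.funLeft ℂ ℂ fun P : A => (⟨P.1, hAZ P.2⟩ : Z)
  set V := LinearMap.range (evMap Z j)
  have hrank := LinearMap.finrank_range_add_finrank_ker (r.domRestrict V)
  have hrange : Module.finrank ℂ (LinearMap.range (r.domRestrict V)) = hilbertFunction A j := by
    rw [hilbertFunction, range_evMap_of_subset hAZ, LinearMap.range_domRestrict]
  have hV : Module.finrank ℂ V = hilbertFunction Z j := rfl
  have hker : LinearMap.ker (r.domRestrict V) = ⊥ := Submodule.finrank_eq_zero.1 (by omega)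
  let f : V := ⟨evMap Z j ⟨F, hF.2⟩, _, rfl⟩
  have hf : f = 0 := by
    apply LinearMap.ker_eq_bot.1 hker
    rw [map_zero]
    ext P
    change evMap Z j ⟨F, hF.2⟩ ⟨P.1, hAZ P.2⟩ = 0
    rw [evMap_apply]
    exact eval_rep_eq_zero_of_mem_idealPiece hF P.2
  intro P hP
  rw [← evMap_apply Z ⟨F, hF.2⟩ ⟨P, hP⟩]
  exact congrFun (congrArg Subtype.val hf) ⟨P, hP⟩

/-- Equality descends to lower degrees: multiply by a power of a coordinate that is nonzero at the
given point. -/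
theorem idealPiece_eq_of_le {n j k : ℕ} {A Z : Finset (PSpace n)} (hAZ : A ⊆ Z)
    (h : idealPiece Z k = idealPiece A k) (hjk : j ≤ k) : idealPiece Z j = idealPiece A j := by
  refine le_antisymm (idealPiece_anti hAZ) fun F hF => ⟨fun v hv hP => ?_, hF.2⟩
  obtain ⟨i, hi⟩ := Function.ne_iff.1 hv
  have hmem : X i ^ (k - j) * F ∈ idealPiece A k := by
    refine ⟨Ideal.mul_mem_left _ _ hF.1, ?_⟩
    have hh := ((isHomogeneous_X ℂ i).pow (k - j)).mul hF.2
    rwa [show 1 * (k - j) + j = k by omega] at hh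
  rw [← h] at hmem
  have h0 := hmem.1 v hv hP
  rw [map_mul, map_pow, eval_X] at h0
  exact (mul_eq_zero.1 h0).resolve_left (pow_ne_zero _ hi)

end Waring

theorem mainTheorem8 [DecidableEq (Waring.PSpace 4)]
    (A B : Finset (Waring.PSpace 4)) (T : Waring.Form 4 4)
    (hA : A.card = 13)
    (h_i : Waring.IsNonRedundant A T)
    (h_ii : Waring.kruskalRank 1 A = 5)
    (h_iii : Waring.kruskalRank 2 A = 13)
    (h_iv' : ∀ A' : Finset (Waring.PSpace 4), A' ⊆ A → A'.card ≤ 11 →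
      (Waring.quadricBaseLocus A').Finite)
    (hB : Waring.Computes B T)
    (hBcard : B.card ≤ 13)
    (hAB : Disjoint A B) :
    B.card = 13 ∧
      (∀ j : ℕ, j ≤ 2 → Waring.idealPiece (A ∪ B) j = Waring.idealPiece A j) ∧
      Waring.hilbertFunction (A ∪ B) 3 ≤ 21 := by
  obtain ⟨B', hB'B, hB'⟩ := hB.exists_isNonRedundant
  have hAB' : Disjoint A B' := hAB.mono_right hB'B
  have h1 := Waring.kruskalRank_le_hilbertFunction 1 A
  have h2 := Waring.kruskalRank_le_hilbertFunction 2 A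
  have hcard := Finset.card_union_of_disjoint hAB'
  have hZ1 := Waring.hilbertFunction_mono (j := 1) (Finset.subset_union_left (s₁ := A) (s₂ := B'))
  have hZ2 := Waring.hilbertFunction_mono (j := 2) (Finset.subset_union_left (s₁ := A) (s₂ := B'))
  have h22 := Waring.hilbertFunction_add_le (i := 2) (j := 2) h_i hB' hAB'
  have h13 := Waring.hilbertFunction_add_le (i := 1) (j := 3) h_i hB' hAB'
  -- From `13 + 13 ≤ 2 h_Z(2) ≤ 13 + ℓ(B')` one gets `ℓ(B') ≥ 13 ≥ ℓ(B)`.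
  obtain rfl : B' = B := Finset.eq_of_subset_of_card_le hB'B (by omega)
  refine ⟨by omega, fun j hj => ?_, by omega⟩
  exact Waring.idealPiece_eq_of_le Finset.subset_union_left
    (Waring.idealPiece_eq_of_hilbertFunction_le Finset.subset_union_left (by omega)) hj
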